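/- Conventions. A *Polish ultrametric space* is a nonempty metric space $U$ whose metric is a complete ultrametric inducing a second-countable topology; its *distance set* is $\{d(x,y) : x,y\in U\}\setminus\{0\}$. The isometry group $\operatorname{Iso}(U)$ carries the topology of pointwise convergence. $U$ is *homogeneous* if $\operatorname{Iso}(U)$ acts transitively on $U$; it is *wide* if for every $r$ in its distance set $U$ contains infinitely many points that are pairwise at distance $r$; it is a *Polish ultrametric Urysohn space* if every isometric embedding of a finite subset of $U$ into $U$ extends to an isometry of $U$ onto itself, and every Polish ultrametric space whose distance set is contained in that of $U$ embeds isometrically into $U$. A *countable linear skeleton* $\langle\Delta,N\rangle$ is a nonempty countable linear order $\Delta$ with a map $\delta\mapsto N_\delta$ assigning to each $\delta\in\Delta$ a cardinal $1\le N_\delta\le\omega$, identified with the set of natural numbers below it; it is *maximal* if $N_\delta=\omega$ for all $\delta$, and *quasi-maximal* if $N_\delta\in\{1,\omega\}$ for all $\delta$. For $x\in\prod_{\delta}N_\delta$ write $x|_\delta$ for the restriction of $x$ to $\{\gamma:\gamma\ge\delta\}$ and $\operatorname{supp}(x)=\{\delta: x(\delta)\ne0\}$. Let $S^{\mathrm{Fin}}$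 be the set of all $x\in\prod_\delta N_\delta$ with finite support, and $S^{\mathrm{LF}}$ the set of all $x$ such that $\operatorname{supp}(x)\cap\{\gamma:\gamma\ge\delta\}$ is finite for every $\delta\in\Delta$. For $S\in\{S^{\mathrm{Fin}},S^{\mathrm{LF}}\}$ the generalized wreath product $\operatorname{Wr}^{S}_{\delta\in\Delta}\operatorname{Sym}(N_\delta)$ (written $\operatorname{Wr}^{\mathrm{Fin}}$, respectively $\operatorname{Wr}^{\mathrm{LF}}$) is the group of all permutations $g$ of $S$ such that for all $x,y\in S$ and $\delta\in\Delta$: (H1) $x|_\delta=y|_\delta$ if and only if $g(x)|_\delta=g(y)|_\delta$; (H2) the map $i\mapsto g(x^\delta_i)(\delta)$ is a permutation of $N_\delta$, where $x^\delta_i$ is any element of $S$ with $x^\delta_i(\delta)=i$ that agrees with $x$ on $\{\gamma:\gamma>\delta\}$. The topology $\tau$ on it is pointwise convergence with respect to the topology on $S$ generated by the sets $\{y\in S: y|_\gamma=x|_\gamma\}$ ($x\in\prod_\delta N_\delta$, $\gamma\in\Delta$); the topology $\tau^*$ is pointwise convergence with respect to the discrete topology on $S$. Theorem. Let $G$ be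 a topological group, and write $\cong$ for isomorphism of topological groups. The following are equivalent: 1. $G\cong\operatorname{Iso}(U)$ for some Polish ultrametric Urysohn space $U$; 2. $G\cong\operatorname{Iso}(U)$ for some homogeneous wide Polish ultrametric space $U$; 3. $G\cong\operatorname{Wr}^{\mathrm{LF}}_{\delta\in\Delta}\operatorname{Sym}(N_\delta)$, with the topology $\tau$, for some quasi-maximal countable linear skeleton $\langle\Delta,N\rangle$. Moreover, the following condition 4 holds if and only if conditions 1, 2, 3 hold and $G$ is nontrivial (so for nontrivial $G$ all four conditions are equivalent): 4. for some maximal countable linear skeleton $\langle\Delta,N\rangle$, either $G\cong\operatorname{Wr}^{\mathrm{LF}}_{\delta\in\Delta}\operatorname{Sym}(N_\delta)$ with the topology $\tau$, or $G\cong\operatorname{Wr}^{\mathrm{Fin}}_{\delta\in\Delta}\operatorname{Sym}(N_\delta)$ with the topology $\tau^*$. -/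

import Mathlib

/-!
Isometry groups of Polish ultrametric spaces, and generalized wreath products of full symmetric
groups over countable linear skeletons.
-/

namespace UltrametricWreath

/-! ### Topological isomorphism -/

/-- `G ≅ H` as topological groups, where `H` carries the topology `τ`. -/
def TopIso (G : Type*) [Group G] [TopologicalSpace G] (H : Type*) [Group H]
    (τ : TopologicalSpace H) : Prop :=
  Nonempty (G ≃ₜ* H)

/-! ### Polish ultrametric spaces -/

/-- A (nonempty) Polish ultrametric space: the metric is a complete ultrametric inducing a
second-countable topology. -/
structure IsPolishUltrametric (U : Type*) [MetricSpace U] : Prop where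
  nonempty : Nonempty U
  ultrametric : IsUltrametricDist U
  complete : CompleteSpace U
  secondCountable : SecondCountableTopology U

/-- The set of nonzero distances realized in `U`. -/
def distanceSet (U : Type*) [MetricSpace U] : Set ℝ :=
  {r | ∃ x y : U, dist x y = r} \ {0}

/-- The topology of pointwise convergence on the isometry group of `U`. -/
abbrev isoTopology (U : Type*) [MetricSpace U] : TopologicalSpace (U ≃ᵢ U) :=
  TopologicalSpace.induced (fun (ψ : U ≃ᵢ U) (x : U) => ψ x) inferInstance

/-- The isometry group acts transitively. -/
def IsHomogeneous (U : Type*) [MetricSpace U] : Prop :=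
  ∀ x y : U, ∃ ψ : U ≃ᵢ U, ψ x = y

/-- For each realized nonzero distance `r` there are infinitely many points which are pairwise at
distance `r`. -/
def IsWide (U : Type*) [MetricSpace U] : Prop :=
  ∀ r ∈ distanceSet U, ∃ x : ℕ → U, ∀ m n, m ≠ n → dist (x m) (x n) = r

/-- Every isometric embedding of a finite subset extends to an isometry of the whole space. -/
def IsUltrahomogeneous (U : Type*) [MetricSpace U] : Prop :=
  ∀ (s : Finset U) (f : s → U), Isometry f → ∃ ψ : U ≃ᵢ U, ∀ x : s, ψ x = f x

/-- Every Polish ultrametric space whose distances are among those of `U` embeds isometrically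
into `U`. (Polish spaces have at most continuum many points, so `Type` is large enough.) -/
def IsUniversal (U : Type*) [MetricSpace U] : Prop :=
  ∀ (X : Type) [MetricSpace X], IsPolishUltrametric X → distanceSet X ⊆ distanceSet U →
    ∃ f : X → U, Isometry f

/-- Polish ultrametric Urysohn spaces. -/
structure IsPolishUrysohn (U : Type*) [MetricSpace U] : Prop where
  polishUltrametric : IsPolishUltrametric U
  ultrahomogeneous : IsUltrahomogeneous U
  universal : IsUniversal U

/-! ### Generalized wreath products -/

section Wreath

variable {Δ : Type*} [PartialOrder Δ]

/-- The cardinal `N δ ≤ ω`, viewed as the set of all natural numbers below it. -/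
abbrev Coord (N : Δ → ℕ∞) (δ : Δ) : Type := {i : ℕ // (i : ℕ∞) < N δ}

/-- `x|_δ = y|_δ`: the sequences `x` and `y` agree on the cone above `δ`. -/
def AgreeFrom {N : Δ → ℕ∞} (δ : Δ) (x y : ∀ δ, Coord N δ) : Prop :=
  ∀ γ, δ ≤ γ → x γ = y γ

/-- The support of a sequence. -/
def supp {N : Δ → ℕ∞} (x : ∀ δ, Coord N δ) : Set Δ := {δ | (x δ : ℕ) ≠ 0}

/-- The domain of all sequences with support in the family `𝒜`. -/
def domainOf (N : Δ → ℕ∞) (𝒜 : Set (Set Δ)) : Set (∀ δ, Coord N δ) := {x | supp x ∈ 𝒜}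

/-- The finite subsets of `Δ`. -/
def FinSupp (Δ : Type*) : Set (Set Δ) := {A | A.Finite}

/-- The locally finite subsets of `Δ`: those with finitely many elements above each `δ`. -/
def LFSupp (Δ : Type*) [PartialOrder Δ] : Set (Set Δ) := {A | ∀ δ, (A ∩ {γ | δ ≤ γ}).Finite}

/-- The generalized wreath product of the permutation groups `H δ` over the domain `S`.
In the second condition `y` ranges over all perturbations of `x` at `δ`, i.e. the elements of `S`
which agree with `x` strictly above `δ`; the condition says that `y δ ↦ g y δ` is (given by) a
permutation in `H δ`. -/
def wreath {N : Δ → ℕ∞} (S : Set (∀ δ, Coord N δ))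
    (H : ∀ δ, Subgroup (Equiv.Perm (Coord N δ))) : Subgroup (Equiv.Perm S) where
  carrier := {g |
    (∀ (x y : S) (δ : Δ), AgreeFrom δ x.1 y.1 ↔ AgreeFrom δ (g x).1 (g y).1) ∧
    (∀ (x : S) (δ : Δ), ∃ σ ∈ H δ, ∀ y : S, (∀ γ, δ < γ → y.1 γ = x.1 γ) →
      (g y).1 δ = σ (y.1 δ))}
  one_mem' := ⟨fun _ _ _ => Iff.rfl, fun _ δ => ⟨1, (H δ).one_mem, fun _ _ => rfl⟩⟩
  mul_mem' := by
    rintro g h ⟨hg, hg'⟩ ⟨hh, hh'⟩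
    refine ⟨fun x y δ => (hh x y δ).trans (hg _ _ δ), fun x δ => ?_⟩
    obtain ⟨σ, hσ, hσ'⟩ := hh' x δ
    obtain ⟨ρ, hρ, hρ'⟩ := hg' (h x) δ
    refine ⟨ρ * σ, (H δ).mul_mem hρ hσ, fun y hy => ?_⟩
    have h1 := hρ' (h y) (fun γ hγ =>
      (hh y x γ).1 (fun ε hε => hy ε (hγ.trans_le hε)) γ le_rfl)
    rw [hσ' y hy] at h1
    exact h1
  inv_mem' := by
    rintro g ⟨hg, hg'⟩
    have hgg : ∀ x : S, g (g⁻¹ x) = x := fun x => g.apply_symm_apply x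
    have hinv : ∀ (x y : S) (δ : Δ), AgreeFrom δ x.1 y.1 ↔
        AgreeFrom δ (g⁻¹ x).1 (g⁻¹ y).1 := fun x y δ => by
      have := hg (g⁻¹ x) (g⁻¹ y) δ
      rw [hgg, hgg] at this
      exact this.symm
    refine ⟨hinv, fun x δ => ?_⟩
    obtain ⟨σ, hσ, hσ'⟩ := hg' (g⁻¹ x) δ
    refine ⟨σ⁻¹, (H δ).inv_mem hσ, fun y hy => ?_⟩
    have h1 := hσ' (g⁻¹ y) (fun γ hγ =>
      (hinv y x γ).1 (fun ε hε => hy ε (hγ.trans_le hε)) γ le_rfl)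
    rw [hgg] at h1
    rw [h1]
    exact (σ.symm_apply_apply _).symm

/-- The generalized wreath product of the full symmetric groups over the family `𝒜` of
admissible supports. -/
abbrev WrSym (N : Δ → ℕ∞) (𝒜 : Set (Set Δ)) : Subgroup (Equiv.Perm (domainOf N 𝒜)) :=
  wreath (domainOf N 𝒜) (fun _ => ⊤)

/-- The topology on sequences generated by the sets `{y | y|_γ = x|_γ}`. -/
abbrev coneTopology (N : Δ → ℕ∞) : TopologicalSpace (∀ δ, Coord N δ) :=
  TopologicalSpace.generateFrom {V | ∃ x γ, V = {y | AgreeFrom γ y x}}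

/-- The topology of pointwise convergence on a group of permutations of a space `(X, t)`. -/
abbrev pointwiseTopology {X : Type*} (t : TopologicalSpace X) (K : Subgroup (Equiv.Perm X)) :
    TopologicalSpace K :=
  TopologicalSpace.induced (fun (g : K) (x : X) => (g : Equiv.Perm X) x)
    (@Pi.topologicalSpace X (fun _ => X) (fun _ => t))

/-- The standard topology `τ` on the wreath product: pointwise convergence with respect to the
relative cone topology on the domain. -/
abbrev tau (N : Δ → ℕ∞) (𝒜 : Set (Set Δ)) : TopologicalSpace (WrSym N 𝒜) :=
  pointwiseTopology (TopologicalSpace.induced Subtype.val (coneTopology N)) (WrSym N 𝒜)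

/-- The topology `τ*` on the wreath product: pointwise convergence with respect to the
discrete topology on the domain. -/
abbrev tauStar (N : Δ → ℕ∞) (𝒜 : Set (Set Δ)) : TopologicalSpace (WrSym N 𝒜) :=
  pointwiseTopology ⊥ (WrSym N 𝒜)

end Wreath

/-! ### Countable linear skeletons -/

/-- A nonempty countable linear order labeled by nonzero cardinals `N δ ≤ ω` (with `ω` written
`⊤`). -/
structure CountableLinearSkeleton where
  Δ : Type
  [linearOrder : LinearOrder Δ]
  [countable : Countable Δ]
  [nonempty : Nonempty Δ]
  N : Δ → ℕ∞
  N_ne_zero : ∀ δ, N δ ≠ 0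

attribute [instance] CountableLinearSkeleton.linearOrder CountableLinearSkeleton.countable
  CountableLinearSkeleton.nonempty

/-- All labels are `ω`. -/
def CountableLinearSkeleton.IsMaximal (K : CountableLinearSkeleton) : Prop :=
  ∀ δ, K.N δ = ⊤

/-- All labels are `1` or `ω`. -/
def CountableLinearSkeleton.IsQuasiMaximal (K : CountableLinearSkeleton) : Prop :=
  ∀ δ, K.N δ = 1 ∨ K.N δ = ⊤

/-! ### The four classes of topological groups -/

section Classes

variable (G : Type*) [Group G] [TopologicalSpace G]

/-- `G` is the isometry group of a Polish ultrametric Urysohn space. -/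
def IsUrysohnIsoGroup : Prop :=
  ∃ (U : Type) (_ : MetricSpace U), IsPolishUrysohn U ∧ TopIso G (U ≃ᵢ U) (isoTopology U)

/-- `G` is the isometry group of a homogeneous wide Polish ultrametric space. -/
def IsHomogeneousWideIsoGroup : Prop :=
  ∃ (U : Type) (_ : MetricSpace U), IsPolishUltrametric U ∧ IsHomogeneous U ∧ IsWide U ∧
    TopIso G (U ≃ᵢ U) (isoTopology U)

/-- `G` is a wreath product with locally finite supports over a quasi-maximal countable linear
skeleton. -/
def IsQuasiMaximalWreath : Prop :=
  ∃ K : CountableLinearSkeleton, K.IsQuasiMaximal ∧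
    TopIso G (WrSym K.N (LFSupp K.Δ)) (tau K.N (LFSupp K.Δ))

/-- `G` is a wreath product with locally finite supports, or one with finite supports and the
topology `τ*`, over a maximal countable linear skeleton. -/
def IsMaximalWreath : Prop :=
  ∃ K : CountableLinearSkeleton, K.IsMaximal ∧
    (TopIso G (WrSym K.N (LFSupp K.Δ)) (tau K.N (LFSupp K.Δ)) ∨
      TopIso G (WrSym K.N (FinSupp K.Δ)) (tauStar K.N (FinSupp K.Δ)))

end Classes

end UltrametricWreath

/-! Over a linear order, two distinct locally finite sequences differ at a largest place. Labeling
the places by an increasing scale of positive reals and taking the label of that place as distance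
gives a complete ultrametric space, `ScaleSpace`. Being closer than the label of `δ` means agreeing
on the cone above `δ`, so (H1) says exactly that a permutation is an isometry. (H2) follows from
(H1) (`mem_wrSym_iff`), and `ScaleSpace.topIso_wreath` identifies the isometry group with the wreath
product.

The spaces are compared through `HasSphereExtension`, which supplies one-point extensions of finite
partial isometries. Back-and-forth then gives ultrahomogeneity and universality, and shows that the
distance set determines the Polish space up to isometry. Homogeneous wide spaces have this property,
and so does `ScaleSpace` over a quasi-maximal skeleton, since a coordinate with infinitely many
values always has a fresh one. Hence every homogeneous wide space is the `ScaleSpace` built from its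
own distances. Conversely, every countable order carries a scale (`nonempty_scale`). Wideness of a
Urysohn space comes from embedding an infinite equidistant space.

For condition 4, places with label 1 carry no information and can be deleted. If the remaining
places are coinitial, local finiteness and the cone topology survive. Otherwise some `β` lies below
all of them, so locally finite means finite and the cone at `β` isolates points, which gives the
finite-support product with `τ*`. Adjoining a bottom place of label 1 reverses this. Nontriviality
says that some label is `ω`. -/

namespace UltrametricWreath

/-! ### Extension of partial isometries between ultrametric spaces -/

section BackAndForth

variable {X U : Type*} [MetricSpace X] [MetricSpace U]

/-- Every finite set of points at distance at most `r` from `a` can be avoided by a point which is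
at distance `r` from `a` and from all of them. -/
def HasSphereExtension (U : Type*) [MetricSpace U] : Prop :=
  ∀ r ∈ distanceSet U, ∀ (a : U) (A : Finset U),
    ∃ u : U, dist u a = r ∧ ∀ b ∈ A, dist a b ≤ r → dist u b = r

/-- A set of pairs which is the graph of an isometry between its two projections. -/
def IsometricRel (R : Set (X × U)) : Prop :=
  ∀ p ∈ R, ∀ q ∈ R, dist p.1 q.1 = dist p.2 q.2

lemma IsometricRel.swap {R : Set (X × U)} (hR : IsometricRel R) :
    IsometricRel (Prod.swap '' R) := by
  rintro _ ⟨p, hp, rfl⟩ _ ⟨q, hq, rfl⟩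
  exact (hR p hp q hq).symm

lemma IsometricRel.insert {R : Set (X × U)} (hR : IsometricRel R) {x : X} {u : U}
    (h : ∀ p ∈ R, dist p.1 x = dist p.2 u) : IsometricRel (insert (x, u) R) := by
  rintro p (rfl | hp) q (rfl | hq)
  · simp
  · simpa [dist_comm] using h q hq
  · exact h p hp
  · exact hR p hp q hq

lemma IsometricRel.closure {R : Set (X × U)} (hR : IsometricRel R) :
    IsometricRel (closure R) := by
  have hc : IsClosed {z : (X × U) × (X × U) | dist z.1.1 z.2.1 = dist z.1.2 z.2.2} :=
    isClosed_eq (by fun_prop) (by fun_prop)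
  have hsub : _root_.closure (R ×ˢ R) ⊆ {z : (X × U) × (X × U) | dist z.1.1 z.2.1 = dist z.1.2 z.2.2} :=
    closure_minimal (fun z hz => hR _ hz.1 _ hz.2) hc
  intro p hp q hq
  exact hsub (by rw [closure_prod_eq]; exact ⟨hp, hq⟩ : (p, q) ∈ _)

/-- On the closure of `R` the first projection is isometric for the max metric, so its range is
complete, hence closed. Being dense as well, it is everything. -/
lemma IsometricRel.exists_mem_closure [CompleteSpace X] [CompleteSpace U] {R : Set (X × U)}
    (hR : IsometricRel R) (hd : Dense (Prod.fst '' R)) (x : X) :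
    ∃ u, (x, u) ∈ _root_.closure R := by
  have hiso : Isometry (fun p : _root_.closure R => p.1.1) := by
    refine Isometry.of_dist_eq fun p q => ?_
    rw [Subtype.dist_eq, Prod.dist_eq, ← hR.closure _ p.2 _ q.2, max_self]
  have : CompleteSpace (_root_.closure R) := isClosed_closure.completeSpace_coe
  have hcl : IsClosed (Set.range fun p : _root_.closure R => p.1.1) :=
    hiso.isClosedEmbedding.isClosed_range
  have hdense : Dense (Set.range fun p : _root_.closure R => p.1.1) := by
    refine hd.mono ?_
    rintro _ ⟨p, hp, rfl⟩
    exact ⟨⟨p, subset_closure hp⟩, rfl⟩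
  obtain ⟨p, rfl⟩ : x ∈ Set.range fun p : _root_.closure R => p.1.1 := by
    rw [← hcl.closure_eq]
    exact hdense x
  exact ⟨p.1.2, p.2⟩

lemma IsometricRel.exists_isometry [CompleteSpace X] [CompleteSpace U] {R : Set (X × U)}
    (hR : IsometricRel R) (hd : Dense (Prod.fst '' R)) :
    ∃ f : X → U, Isometry f ∧ ∀ p ∈ R, f p.1 = p.2 := by
  choose f hf using hR.exists_mem_closure hd
  refine ⟨f, Isometry.of_dist_eq fun x y => (hR.closure _ (hf x) _ (hf y)).symm, fun p hp => ?_⟩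
  have := hR.closure _ (hf p.1) _ (subset_closure hp)
  simpa using this.symm

lemma IsometricRel.exists_isometryEquiv [CompleteSpace X] [CompleteSpace U] {R : Set (X × U)}
    (hR : IsometricRel R) (hd : Dense (Prod.fst '' R)) (hd' : Dense (Prod.snd '' R)) :
    ∃ f : X ≃ᵢ U, ∀ p ∈ R, f p.1 = p.2 := by
  choose f hf using hR.exists_mem_closure hd
  have hd'' : Dense (Prod.fst '' (Prod.swap '' R)) := by
    rwa [Set.image_image]
  choose g hg using hR.swap.exists_mem_closure hd''
  have hg' : ∀ u, (g u, u) ∈ _root_.closure R := fun u => by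
    have h := image_closure_subset_closure_image continuous_swap (Set.mem_image_of_mem _ (hg u))
    rwa [Set.image_image, Set.image_congr fun p _ => Prod.swap_swap p, Set.image_id'] at h
  refine ⟨IsometryEquiv.mk' f g (fun u => ?_)
    (Isometry.of_dist_eq fun x y => (hR.closure _ (hf x) _ (hf y)).symm), fun p hp => ?_⟩
  · have := hR.closure _ (hf (g u)) _ (hg' u)
    simpa using this.symm
  · have := hR.closure _ (hf p.1) _ (subset_closure hp)
    exact dist_eq_zero.1 (this.symm.trans (dist_self _))

/-- One-point extension of a finite partial isometry. -/
lemma HasSphereExtension.exists_extension [IsUltrametricDist X] [IsUltrametricDist U] [Nonempty U]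
    (hU : HasSphereExtension U) (hD : distanceSet X ⊆ distanceSet U) (s : Finset (X × U))
    (hs : IsometricRel (s : Set (X × U))) (x : X) :
    ∃ u : U, ∀ p ∈ s, dist p.1 x = dist p.2 u := by
  classical
  rcases s.eq_empty_or_nonempty with rfl | hne
  · exact ⟨Classical.arbitrary U, by simp⟩
  -- The distances to a point of the domain closest to `x` determine all others: a point `q` further
  -- from `p` than `x` is has the same distance to `x` as to `p`, and the remaining ones lie at the
  -- minimal distance from `x`.
  obtain ⟨p, hp, hmin⟩ := s.exists_min_image (fun p => dist p.1 x) hne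
  rcases eq_or_ne (dist p.1 x) 0 with h0 | h0
  · refine ⟨p.2, fun q hq => ?_⟩
    rw [← dist_eq_zero.1 h0]
    exact hs q hq p hp
  obtain ⟨u, hu, hu'⟩ := hU _ (hD ⟨⟨p.1, x, rfl⟩, h0⟩) p.2 (s.image Prod.snd)
  refine ⟨u, fun q hq => ?_⟩
  have hpq : dist q.1 p.1 = dist q.2 p.2 := hs q hq p hp
  rcases le_or_gt (dist p.2 q.2) (dist p.1 x) with hle | hlt
  · rw [dist_comm q.2, hu' q.2 (Finset.mem_image_of_mem _ hq) hle]
    refine le_antisymm ((dist_triangle_max q.1 p.1 x).trans (max_le ?_ le_rfl)) (hmin q hq)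
    rwa [hpq, dist_comm]
  · rw [dist_comm p.2, ← hpq] at hlt
    have hlt' : dist p.2 u < dist q.2 p.2 := by rw [dist_comm p.2, hu, ← hpq]; exact hlt
    rw [IsUltrametricDist.dist_eq_max_of_dist_ne_dist q.1 p.1 x hlt.ne',
      IsUltrametricDist.dist_eq_max_of_dist_ne_dist q.2 p.2 u hlt'.ne',
      max_eq_left hlt.le, max_eq_left hlt'.le, hpq]

/-- Finite partial isometries, ordered by extension. -/
abbrev FinitePartialIsometry (X U : Type*) [MetricSpace X] [MetricSpace U] : Type _ :=
  {s : Finset (X × U) // IsometricRel (s : Set (X × U))}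

/-- The finite partial isometries defined at `x`. -/
def definedAt [IsUltrametricDist X] [IsUltrametricDist U] [Nonempty U]
    (hU : HasSphereExtension U) (hD : distanceSet X ⊆ distanceSet U) (x : X) :
    Order.Cofinal (FinitePartialIsometry X U) where
  carrier := {s | ∃ u, (x, u) ∈ s.1}
  isCofinal := by
    classical
    intro s
    obtain ⟨u, hu⟩ := hU.exists_extension hD s.1 s.2 x
    refine ⟨⟨insert (x, u) s.1, ?_⟩, ⟨u, Finset.mem_insert_self _ _⟩, Finset.subset_insert _ _⟩
    rw [Finset.coe_insert]
    exact s.2.insert hu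

/-- The finite partial isometries taking the value `u`. -/
def attaining [IsUltrametricDist X] [IsUltrametricDist U] [Nonempty X]
    (hX : HasSphereExtension X) (hD : distanceSet U ⊆ distanceSet X) (u : U) :
    Order.Cofinal (FinitePartialIsometry X U) where
  carrier := {s | ∃ x, (x, u) ∈ s.1}
  isCofinal := by
    classical
    intro s
    obtain ⟨x, hx⟩ := hX.exists_extension hD (s.1.image Prod.swap)
      (by rw [Finset.coe_image]; exact s.2.swap) u
    refine ⟨⟨insert (x, u) s.1, ?_⟩, ⟨x, Finset.mem_insert_self _ _⟩, Finset.subset_insert _ _⟩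
    rw [Finset.coe_insert]
    exact s.2.insert fun p hp => (hx _ (Finset.mem_image_of_mem _ hp)).symm

lemma isometricRel_ideal (I : Order.Ideal (FinitePartialIsometry X U)) :
    IsometricRel {p : X × U | ∃ s ∈ I, p ∈ s.1} := by
  rintro p ⟨s, hs, hp⟩ q ⟨t, ht, hq⟩
  obtain ⟨w, -, hsw, htw⟩ := I.directed s hs t ht
  exact w.2 p (hsw hp) q (htw hq)

lemma dense_image_of_denseSeq {Z Y : Type*} [TopologicalSpace Y] [TopologicalSpace.SeparableSpace Y]
    [Nonempty Y] {R : Set Z} {f : Z → Y}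
    (h : ∀ n, TopologicalSpace.denseSeq Y n ∈ f '' R) : Dense (f '' R) :=
  (TopologicalSpace.denseRange_denseSeq Y).mono (Set.range_subset_iff.2 h)

/-- A space with sphere extensions contains every ultrametric Polish space with no further
distances. -/
theorem HasSphereExtension.exists_isometry (hU : HasSphereExtension U)
    (hU' : IsPolishUltrametric U) (hX : IsPolishUltrametric X)
    (hD : distanceSet X ⊆ distanceSet U) : ∃ f : X → U, Isometry f := by
  obtain ⟨_, _, _, _⟩ := hU'
  obtain ⟨_, _, _, _⟩ := hX
  let p : FinitePartialIsometry X U := ⟨∅, by simp [IsometricRel]⟩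
  let D : ℕ → Order.Cofinal (FinitePartialIsometry X U) :=
    fun n => definedAt hU hD (TopologicalSpace.denseSeq X n)
  let I := Order.idealOfCofinals p D
  obtain ⟨f, hf, -⟩ := (isometricRel_ideal I).exists_isometry (dense_image_of_denseSeq fun n => by
    obtain ⟨s, ⟨u, hu⟩, hs⟩ := Order.cofinal_meets_idealOfCofinals p D n
    exact ⟨_, ⟨s, hs, hu⟩, rfl⟩)
  exact ⟨f, hf⟩

/-- Back-and-forth: between spaces with sphere extensions and the same distances, every finite
partial isometry extends to a surjective isometry. -/
theorem HasSphereExtension.exists_isometryEquiv (hU : HasSphereExtension U)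
    (hX : HasSphereExtension X) (hU' : IsPolishUltrametric U) (hX' : IsPolishUltrametric X)
    (hD : distanceSet X = distanceSet U) (s : Finset (X × U))
    (hs : IsometricRel (s : Set (X × U))) : ∃ f : X ≃ᵢ U, ∀ p ∈ s, f p.1 = p.2 := by
  obtain ⟨_, _, _, _⟩ := hU'
  obtain ⟨_, _, _, _⟩ := hX'
  let p : FinitePartialIsometry X U := ⟨s, hs⟩
  let D : ℕ ⊕ ℕ → Order.Cofinal (FinitePartialIsometry X U) :=
    Sum.elim (fun n => definedAt hU hD.le (TopologicalSpace.denseSeq X n))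
      (fun n => attaining hX hD.ge (TopologicalSpace.denseSeq U n))
  let I := Order.idealOfCofinals p D
  obtain ⟨f, hf⟩ := (isometricRel_ideal I).exists_isometryEquiv
    (dense_image_of_denseSeq fun n => by
      obtain ⟨s, ⟨u, hu⟩, hs⟩ := Order.cofinal_meets_idealOfCofinals p D (Sum.inl n)
      exact ⟨_, ⟨s, hs, hu⟩, rfl⟩)
    (dense_image_of_denseSeq fun n => by
      obtain ⟨s, ⟨u, hu⟩, hs⟩ := Order.cofinal_meets_idealOfCofinals p D (Sum.inr n)
      exact ⟨_, ⟨s, hs, hu⟩, rfl⟩)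
  exact ⟨f, fun p hp => hf p ⟨_, Order.mem_idealOfCofinals _ _, hp⟩⟩

/-- A Polish ultrametric space with sphere extensions is a Urysohn space. -/
theorem HasSphereExtension.isPolishUrysohn (hU : HasSphereExtension U)
    (hU' : IsPolishUltrametric U) : IsPolishUrysohn U := by
  classical
  refine ⟨hU', fun s f hf => ?_, fun X _ hX hD => hU.exists_isometry hU' hX hD⟩
  obtain ⟨ψ, hψ⟩ := hU.exists_isometryEquiv hU hU' hU' rfl
    (Finset.univ.image fun x : s => (x.1, f x)) (by
      intro p hp q hq
      simp only [Finset.coe_image, Finset.coe_univ, Set.image_univ, Set.mem_range] at hp hq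
      obtain ⟨x, rfl⟩ := hp
      obtain ⟨y, rfl⟩ := hq
      exact (hf.dist_eq x y).symm)
  exact ⟨ψ, fun x => hψ (x.1, f x) (Finset.mem_image_of_mem _ (Finset.mem_univ x))⟩

/-- Homogeneous wide ultrametric spaces have sphere extensions. -/
theorem IsHomogeneous.hasSphereExtension [IsUltrametricDist U] (hU : IsHomogeneous U)
    (hw : IsWide U) : HasSphereExtension U := by
  intro r hr a A
  have hr0 : 0 < r := by
    obtain ⟨⟨x, y, rfl⟩, h0⟩ := hr
    exact lt_of_le_of_ne dist_nonneg (Ne.symm h0)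
  obtain ⟨x, hx⟩ := hw r hr
  obtain ⟨ψ, hψ⟩ := hU (x 0) a
  have hy : ∀ m n, m ≠ n → dist (ψ (x m)) (ψ (x n)) = r := fun m n h => by
    rw [ψ.dist_eq, hx m n h]
  -- By the ultrametric inequality each `b` is closer than `r` to at most one of the equidistant
  -- points. Index 0 is excluded because that point is `a` itself.
  have hfin : ({0} ∪ ⋃ b ∈ A, {n | dist (ψ (x n)) b < r} : Set ℕ).Finite := by
    refine (Set.finite_singleton 0).union (A.finite_toSet.biUnion fun b _ => ?_)
    refine Set.Subsingleton.finite fun m hm n hn => ?_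
    by_contra hmn
    refine (hy m n hmn).not_lt ((dist_triangle_max _ b _).trans_lt (max_lt hm ?_))
    rw [dist_comm]
    exact hn
  obtain ⟨n, hn⟩ := hfin.exists_notMem
  simp only [Set.mem_union, Set.mem_singleton_iff, Set.mem_iUnion, Set.mem_ofPred_eq, not_or,
    not_exists, not_lt] at hn
  have hna : dist (ψ (x n)) a = r := hψ ▸ hy n 0 hn.1
  exact ⟨ψ (x n), hna, fun b hb hab => le_antisymm
    ((dist_triangle_max _ a _).trans (max_le hna.le hab)) (hn.2 b hb)⟩

lemma IsUltrahomogeneous.isHomogeneous (hU : IsUltrahomogeneous U) : IsHomogeneous U := by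
  intro x y
  obtain ⟨ψ, hψ⟩ := hU {x} (fun _ => y) (Isometry.of_dist_eq fun a b => by
    have : a = b := Subsingleton.elim a b
    simp [this])
  exact ⟨ψ, hψ ⟨x, Finset.mem_singleton_self x⟩⟩

end BackAndForth

/-! ### Topological isomorphisms between groups of permutations -/

lemma TopIso.trans {G H L : Type*} [Group G] {ρ : TopologicalSpace G} [Group H] [Group L]
    {τ : TopologicalSpace H} {σ : TopologicalSpace L} (h : TopIso G H τ) (h' : TopIso H L σ) :
    TopIso G L σ :=
  ⟨h.some.trans h'.some⟩

lemma TopIso.symm {G H : Type*} [Group G] {σ : TopologicalSpace G} [Group H]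
    {τ : TopologicalSpace H} (h : TopIso G H τ) : TopIso H G σ :=
  ⟨h.some.symm⟩

/-- A group isomorphism that intertwines two actions along a homeomorphism is a homeomorphism for
the topologies of pointwise convergence. -/
lemma topIso_of_equivariant {A B X Y : Type*} [Group A] [Group B] [tX : TopologicalSpace X]
    [tY : TopologicalSpace Y] (a : A → X → X) (b : B → Y → Y) (φ : X ≃ Y)
    (hφ : tX = tY.induced φ) (e : A ≃* B) (h : ∀ g x, b (e g) (φ x) = φ (a g x)) :
    @TopIso A _ (TopologicalSpace.induced a inferInstance) B _
      (TopologicalSpace.induced b inferInstance) := by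
  let _ : TopologicalSpace A := TopologicalSpace.induced a inferInstance
  let _ : TopologicalSpace B := TopologicalSpace.induced b inferInstance
  let φ' : X ≃ₜ Y := φ.toHomeomorphOfIsInducing ⟨hφ⟩
  have hφ' : ∀ x, φ' x = φ x := fun _ => rfl
  have ha : ∀ x, Continuous fun g => a g x := fun x =>
    (continuous_apply x).comp continuous_induced_dom
  have hb : ∀ y, Continuous fun g => b g y := fun y =>
    (continuous_apply y).comp continuous_induced_dom
  refine ⟨{ e with continuous_toFun := ?_, continuous_invFun := ?_ }⟩
  · refine continuous_induced_rng.2 (continuous_pi fun y => ?_)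
    have : (fun g => b (e g) y) = fun g => φ' (a g (φ'.symm y)) := by
      funext g
      rw [hφ', ← h, ← hφ', φ'.apply_symm_apply]
    exact this ▸ φ'.continuous.comp (ha _)
  · refine continuous_induced_rng.2 (continuous_pi fun x => ?_)
    have : (fun g => a (e.symm g) x) = fun g => φ'.symm (b g (φ' x)) := by
      funext g
      rw [φ'.eq_symm_apply, hφ', hφ', ← h, e.apply_symm_apply]
    exact this ▸ φ'.symm.continuous.comp (hb _)

lemma topIso_isometryEquiv {U V : Type*} [MetricSpace U] [MetricSpace V] (φ : U ≃ᵢ V) :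
    @TopIso (U ≃ᵢ U) _ (isoTopology U) (V ≃ᵢ V) _ (isoTopology V) := by
  refine topIso_of_equivariant (fun (ψ : U ≃ᵢ U) x => ψ x) (fun (ψ : V ≃ᵢ V) x => ψ x) φ.toEquiv
    φ.toHomeomorph.isInducing.eq_induced
    { toFun := fun ψ => (φ.symm.trans ψ).trans φ
      invFun := fun ψ => (φ.trans ψ).trans φ.symm
      left_inv := fun ψ => by ext; simp
      right_inv := fun ψ => by ext; simp
      map_mul' := fun ψ χ => by ext; simp } fun ψ x => ?_
  simp

/-! ### Generalized wreath products of full symmetric groups -/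

/-- Families of supports which allow the change of a single coordinate. -/
def IsStable {Δ : Type*} (𝒜 : Set (Set Δ)) : Prop :=
  ∀ A ∈ 𝒜, ∀ δ, ∀ B ⊆ insert δ A, B ∈ 𝒜

lemma isStable_finSupp {Δ : Type*} : IsStable (FinSupp Δ) :=
  fun _ hA δ _ hB => Set.Finite.subset (Set.Finite.insert δ hA) hB

lemma isStable_lfSupp {Δ : Type*} [PartialOrder Δ] : IsStable (LFSupp Δ) :=
  fun _ hA δ _ hB ε =>
  ((hA ε).insert δ).subset fun _ hγ => (hB hγ.1).imp_right fun h => ⟨h, hγ.2⟩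

lemma eq_of_coord_one {Δ : Type*} {N : Δ → ℕ∞} {δ : Δ} (h : N δ = 1) (i j : Coord N δ) :
    i = j := by
  obtain ⟨i, hi⟩ := i
  obtain ⟨j, hj⟩ := j
  rw [h] at hi hj
  have hi' : i < 1 := by exact_mod_cast hi
  have hj' : j < 1 := by exact_mod_cast hj
  exact Subtype.ext (by simp; omega)

lemma IsStable.update_mem {Δ : Type*} [DecidableEq Δ] {N : Δ → ℕ∞} {𝒜 : Set (Set Δ)}
    (h𝒜 : IsStable 𝒜) {x : ∀ δ, Coord N δ} (hx : x ∈ domainOf N 𝒜) (δ : Δ) (i : Coord N δ) :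
    Function.update x δ i ∈ domainOf N 𝒜 := by
  refine h𝒜 _ hx δ _ fun γ hγ => ?_
  by_cases h : γ = δ
  · exact Or.inl h
  · refine Or.inr ?_
    simpa [supp, Function.update_of_ne h] using hγ

section Wreath

variable {Δ : Type*} [PartialOrder Δ] {N : Δ → ℕ∞}

lemma AgreeFrom.symm {δ : Δ} {x y : ∀ δ, Coord N δ} (h : AgreeFrom δ x y) : AgreeFrom δ y x :=
  fun γ hγ => (h γ hγ).symm

lemma AgreeFrom.trans {δ : Δ} {x y z : ∀ δ, Coord N δ} (h : AgreeFrom δ x y)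
    (h' : AgreeFrom δ y z) : AgreeFrom δ x z :=
  fun γ hγ => (h γ hγ).trans (h' γ hγ)

lemma AgreeFrom.mono {δ ε : Δ} (hε : δ ≤ ε) {x y : ∀ δ, Coord N δ} (h : AgreeFrom δ x y) :
    AgreeFrom ε x y :=
  fun γ hγ => h γ (hε.trans hγ)

/-- In the wreath product of full symmetric groups the second condition is redundant. -/
lemma mem_wrSym_iff {𝒜 : Set (Set Δ)} (h𝒜 : IsStable 𝒜) {g : Equiv.Perm (domainOf N 𝒜)} :
    g ∈ WrSym N 𝒜 ↔ ∀ (x y : domainOf N 𝒜) (δ : Δ),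
      AgreeFrom δ x.1 y.1 ↔ AgreeFrom δ (g x).1 (g y).1 := by
  classical
  refine ⟨fun hg => hg.1, fun hg => ⟨hg, fun x δ => ?_⟩⟩
  -- Agreement strictly above `δ` is agreement on every cone starting above `δ`, so `g` preserves
  -- and reflects it.
  have habove : ∀ y z : domainOf N 𝒜, (∀ γ, δ < γ → y.1 γ = z.1 γ) ↔
      ∀ γ, δ < γ → (g y).1 γ = (g z).1 γ := fun y z =>
    ⟨fun h γ hγ => (hg y z γ).1 (fun ε hε => h ε (hγ.trans_le hε)) γ le_rfl,
      fun h γ hγ => (hg y z γ).2 (fun ε hε => h ε (hγ.trans_le hε)) γ le_rfl⟩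
  have hfrom : ∀ y z : ∀ δ, Coord N δ, (∀ γ, δ < γ → y γ = z γ) → y δ = z δ →
      AgreeFrom δ y z := fun y z h h' γ hγ => by
    rcases hγ.eq_or_lt with rfl | hγ
    · exact h'
    · exact h γ hγ
  let u : Coord N δ → domainOf N 𝒜 := fun i => ⟨_, h𝒜.update_mem x.2 δ i⟩
  have hu : ∀ i, (u i).1 δ = i := fun i => Function.update_self δ i x.1
  have hu' : ∀ i γ, δ < γ → (u i).1 γ = x.1 γ := fun i γ hγ => Function.update_of_ne hγ.ne' _ _
  have key : ∀ y : domainOf N 𝒜, (∀ γ, δ < γ → y.1 γ = x.1 γ) →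
      (g y).1 δ = (g (u (y.1 δ))).1 δ := fun y hy =>
    (hg _ _ δ).1 (hfrom _ _ (fun γ hγ => (hy γ hγ).trans (hu' _ γ hγ).symm) (hu _).symm) δ le_rfl
  have hbij : Function.Bijective fun i => (g (u i)).1 δ := by
    refine ⟨fun i j hij => ?_, fun k => ?_⟩
    · have h1 : ∀ γ, δ < γ → (u i).1 γ = (u j).1 γ := fun γ hγ =>
        (hu' i γ hγ).trans (hu' j γ hγ).symm
      have h2 := (hg (u i) (u j) δ).2 (hfrom _ _ ((habove _ _).1 h1) hij) δ le_rfl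
      rwa [hu, hu] at h2
    -- Surjectivity: pull back along `g` the sequence `g x` with its `δ`-coordinate replaced by `k`.
    · obtain ⟨w, hw⟩ := g.surjective ⟨_, h𝒜.update_mem (g x).2 δ k⟩
      refine ⟨w.1 δ, (key w ((habove w x).2 fun γ hγ => ?_)).symm.trans ?_⟩
      · rw [hw]
        exact Function.update_of_ne hγ.ne' k (g x).1
      · rw [hw]
        exact Function.update_self δ k (g x).1
  exact ⟨Equiv.ofBijective _ hbij, Subgroup.mem_top _, key⟩

end Wreath

/-! ### The cone topology -/

section ConeTopology

variable {Δ : Type*} [LinearOrder Δ] [Nonempty Δ] {N : Δ → ℕ∞}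

/-- Linearity of the order makes the cones around a point nested, so the generating sets already
form a basis; nonemptiness of `Δ` is what makes them cover. -/
lemma isOpen_cone_iff {S : Set (∀ δ, Coord N δ)} {V : Set S} :
    @IsOpen S (TopologicalSpace.induced Subtype.val (coneTopology N)) V ↔
      ∀ y ∈ V, ∃ γ, ∀ z : S, AgreeFrom γ z.1 y.1 → z ∈ V := by
  constructor
  · rintro ⟨W, hW, rfl⟩
    suffices ∀ y ∈ W, ∃ γ, ∀ z, AgreeFrom γ z y → z ∈ W from fun y hy =>
      (this y.1 hy).imp fun γ h z hz => h z.1 hz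
    induction hW with
    | basic W hW =>
      obtain ⟨x, γ, rfl⟩ := hW
      exact fun y hy => ⟨γ, fun z hz => hz.trans hy⟩
    | univ => exact fun y _ => ⟨Classical.arbitrary Δ, fun _ _ => trivial⟩
    | inter s t _ _ hs ht =>
      intro y hy
      obtain ⟨γ, hγ⟩ := hs y hy.1
      obtain ⟨ε, hε⟩ := ht y hy.2
      exact ⟨min γ ε, fun z hz => ⟨hγ z (hz.mono (min_le_left _ _)),
        hε z (hz.mono (min_le_right _ _))⟩⟩
    | sUnion T _ hT =>
      rintro y ⟨s, hs, hy⟩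
      obtain ⟨γ, hγ⟩ := hT s hs y hy
      exact ⟨γ, fun z hz => ⟨s, hs, hγ z hz⟩⟩
  · intro h
    choose! γ hγ using h
    refine ⟨⋃ y ∈ V, {z | AgreeFrom (γ y) z y.1}, ?_, ?_⟩
    · let _ := coneTopology N
      refine isOpen_biUnion fun y _ => ?_
      exact TopologicalSpace.isOpen_generateFrom_of_mem ⟨y.1, γ y, rfl⟩
    · ext z
      simp only [Set.preimage_iUnion, Set.mem_iUnion]
      exact ⟨fun ⟨y, hy, hz⟩ => hγ y hy z hz, fun hz => ⟨z, hz, fun _ _ => rfl⟩⟩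

end ConeTopology

/-! ### Removing trivial coordinates -/

section Restrict

variable {Δ Γ : Type*} [LinearOrder Δ] [LinearOrder Γ] {N : Δ → ℕ∞}

/-- Restriction of sequences along `ι`. -/
def restrict (ι : Γ ↪o Δ) (x : ∀ δ, Coord N δ) : ∀ γ, Coord (fun γ => N (ι γ)) γ :=
  fun γ => x (ι γ)

lemma agreeFrom_iff_of_range {ι : Γ ↪o Δ} (hι : ∀ δ, δ ∉ Set.range ι → N δ = 1) {δ : Δ}
    {x y : ∀ δ, Coord N δ} :
    AgreeFrom δ x y ↔ ∀ γ, δ ≤ ι γ → restrict ι x γ = restrict ι y γ := by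
  refine ⟨fun h γ hγ => h _ hγ, fun h ε hε => ?_⟩
  by_cases hr : ε ∈ Set.range ι
  · obtain ⟨γ, rfl⟩ := hr
    exact h γ hε
  · exact eq_of_coord_one (hι _ hr) _ _

lemma agreeFrom_apply_iff {ι : Γ ↪o Δ} (hι : ∀ δ, δ ∉ Set.range ι → N δ = 1) {γ : Γ}
    {x y : ∀ δ, Coord N δ} :
    AgreeFrom (ι γ) x y ↔ AgreeFrom γ (restrict ι x) (restrict ι y) := by
  rw [agreeFrom_iff_of_range hι]
  exact forall_congr' fun ε => by rw [ι.le_iff_le]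

/-- This reduces (H1) at a deleted place to (H1) at the places that remain above it. -/
lemma agreeFrom_iff_forall {ι : Γ ↪o Δ} (hι : ∀ δ, δ ∉ Set.range ι → N δ = 1) {δ : Δ}
    {x y : ∀ δ, Coord N δ} :
    AgreeFrom δ x y ↔ ∀ γ, δ ≤ ι γ → AgreeFrom γ (restrict ι x) (restrict ι y) := by
  rw [agreeFrom_iff_of_range hι]
  exact ⟨fun h γ hγ ε hε => h ε (hγ.trans (ι.le_iff_le.2 hε)), fun h γ hγ => h γ hγ γ le_rfl⟩

lemma supp_eq_image {ι : Γ ↪o Δ} (hι : ∀ δ, δ ∉ Set.range ι → N δ = 1) (x : ∀ δ, Coord N δ) :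
    supp x = ι '' supp (restrict ι x) := by
  ext δ
  constructor
  · intro h
    by_cases hr : δ ∈ Set.range ι
    · obtain ⟨γ, rfl⟩ := hr
      exact ⟨γ, h, rfl⟩
    · have hlt : ((x δ).1 : ℕ∞) < 1 := (x δ).2.trans_eq (hι δ hr)
      exact absurd (Nat.lt_one_iff.1 (by exact_mod_cast hlt)) h
  · rintro ⟨γ, h, rfl⟩
    exact h

/-- If all coordinates outside the range of `ι` are trivial, restriction along `ι` is a bijection
between the domains given by matching families of supports. -/
noncomputable def restrictEquiv (ι : Γ ↪o Δ) (hι : ∀ δ, δ ∉ Set.range ι → N δ = 1)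
    {𝒜 : Set (Set Δ)} {ℬ : Set (Set Γ)} (h : ∀ B, B ∈ ℬ ↔ ι '' B ∈ 𝒜) :
    domainOf N 𝒜 ≃ domainOf (fun γ => N (ι γ)) ℬ :=
  Equiv.ofBijective
    (fun x => ⟨restrict ι x.1, (h _).2 (by rw [← supp_eq_image hι]; exact x.2)⟩) <| by
    classical
    constructor
    · intro x y hxy
      refine Subtype.ext (funext fun δ => ?_)
      by_cases hr : δ ∈ Set.range ι
      · obtain ⟨γ, rfl⟩ := hr
        exact congrFun (congrArg Subtype.val hxy) γ
      · exact eq_of_coord_one (hι _ hr) _ _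
    · intro y
      let x : ∀ δ, Coord N δ := fun δ =>
        ⟨if hr : ∃ γ, ι γ = δ then (y.1 hr.choose).1 else 0, by
          split_ifs with hr
          · exact (y.1 hr.choose).2.trans_eq (congrArg N hr.choose_spec)
          · rw [hι δ hr]
            exact_mod_cast Nat.zero_lt_one⟩
      have hx : restrict ι x = y.1 := by
        funext γ
        have hr : ∃ γ', ι γ' = ι γ := ⟨γ, rfl⟩
        refine Subtype.ext ?_
        have h1 : hr.choose = γ := ι.injective hr.choose_spec
        simp only [restrict, x, dif_pos hr]
        rw [h1]
      refine ⟨⟨x, ?_⟩, Subtype.ext hx⟩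
      show supp x ∈ 𝒜
      rw [supp_eq_image hι, ← h, hx]
      exact y.2

lemma coe_restrictEquiv (ι : Γ ↪o Δ) (hι : ∀ δ, δ ∉ Set.range ι → N δ = 1)
    {𝒜 : Set (Set Δ)} {ℬ : Set (Set Γ)} (h : ∀ B, B ∈ ℬ ↔ ι '' B ∈ 𝒜) (x : domainOf N 𝒜) :
    (restrictEquiv ι hι h x).1 = restrict ι x.1 :=
  rfl

/-- Removal of trivial coordinates does not change the wreath product. -/
lemma topIso_restrict (ι : Γ ↪o Δ) (hι : ∀ δ, δ ∉ Set.range ι → N δ = 1)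
    {𝒜 : Set (Set Δ)} {ℬ : Set (Set Γ)} (h : ∀ B, B ∈ ℬ ↔ ι '' B ∈ 𝒜)
    (h𝒜 : IsStable 𝒜) (hℬ : IsStable ℬ) (t : TopologicalSpace (domainOf N 𝒜))
    (t' : TopologicalSpace (domainOf (fun γ => N (ι γ)) ℬ))
    (ht : t = t'.induced (restrictEquiv ι hι h)) :
    @TopIso (WrSym N 𝒜) _ (pointwiseTopology t _) (WrSym (fun γ => N (ι γ)) ℬ) _
      (pointwiseTopology t' _) := by
  have key : ∀ g : Equiv.Perm (domainOf N 𝒜), g ∈ WrSym N 𝒜 ↔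
      (restrictEquiv ι hι h).permCongrHom g ∈ WrSym (fun γ => N (ι γ)) ℬ := by
    intro g
    rw [mem_wrSym_iff h𝒜, mem_wrSym_iff hℬ]
    constructor
    · intro hg x y γ
      obtain ⟨x, rfl⟩ := (restrictEquiv ι hι h).surjective x
      obtain ⟨y, rfl⟩ := (restrictEquiv ι hι h).surjective y
      simp only [Equiv.permCongrHom_coe, Equiv.permCongr_apply, Equiv.symm_apply_apply,
        coe_restrictEquiv, ← agreeFrom_apply_iff hι]
      exact hg x y (ι γ)
    · intro hg x y δ
      rw [agreeFrom_iff_forall hι, agreeFrom_iff_forall hι]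
      refine forall₂_congr fun γ _ => ?_
      have := hg (restrictEquiv ι hι h x) (restrictEquiv ι hι h y) γ
      simpa only [Equiv.permCongrHom_coe, Equiv.permCongr_apply, Equiv.symm_apply_apply,
        coe_restrictEquiv] using this
  refine topIso_of_equivariant (fun (g : WrSym N 𝒜) x => g.1 x)
    (fun (g : WrSym (fun γ => N (ι γ)) ℬ) x => g.1 x) (restrictEquiv ι hι h) ht
    { toFun := fun g => ⟨(restrictEquiv ι hι h).permCongrHom g.1, (key _).1 g.2⟩
      invFun := fun g => ⟨(restrictEquiv ι hι h).permCongrHom.symm g.1, (key _).2 (by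
        rw [MulEquiv.apply_symm_apply]
        exact g.2)⟩
      left_inv := fun g => Subtype.ext (MulEquiv.symm_apply_apply _ _)
      right_inv := fun g => Subtype.ext (MulEquiv.apply_symm_apply _ _)
      map_mul' := fun g g' => Subtype.ext (map_mul _ _ _) } fun g x => ?_
  simp

/-- Coordinates may be removed from a locally finite wreath product if coinitially many remain. -/
lemma topIso_restrict_of_coinitial [Nonempty Δ] [Nonempty Γ] (ι : Γ ↪o Δ)
    (hι : ∀ δ, δ ∉ Set.range ι → N δ = 1) (hco : ∀ δ, ∃ γ, ι γ ≤ δ) :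
    @TopIso (WrSym N (LFSupp Δ)) _ (tau N (LFSupp Δ))
      (WrSym (fun γ => N (ι γ)) (LFSupp Γ)) _ (tau (fun γ => N (ι γ)) (LFSupp Γ)) := by
  have h : ∀ B, B ∈ LFSupp Γ ↔ ι '' B ∈ LFSupp Δ := by
    refine fun B => ⟨fun hB δ => ?_, fun hB γ => ?_⟩
    · obtain ⟨γ, hγ⟩ := hco δ
      refine ((hB γ).image ι).subset ?_
      rintro _ ⟨⟨ε, hε, rfl⟩, h⟩
      exact ⟨ε, ⟨hε, ι.le_iff_le.1 (hγ.trans h)⟩, rfl⟩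
    · refine Set.Finite.of_finite_image ((hB (ι γ)).subset ?_) ι.injective.injOn
      rintro _ ⟨ε, ⟨hε, h⟩, rfl⟩
      exact ⟨⟨ε, hε, rfl⟩, ι.le_iff_le.2 h⟩
  refine topIso_restrict ι hι h isStable_lfSupp isStable_lfSupp _ _ (TopologicalSpace.ext_iff.2 ?_)
  intro V
  refine isOpen_cone_iff.trans ?_
  constructor
  · intro hV
    refine ⟨(restrictEquiv ι hι h).symm ⁻¹' V, isOpen_cone_iff.2 fun y hy => ?_, ?_⟩
    · obtain ⟨δ, hδ⟩ := hV _ hy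
      obtain ⟨γ, hγ⟩ := hco δ
      refine ⟨γ, fun z hz => hδ _ (AgreeFrom.mono hγ ?_)⟩
      rwa [agreeFrom_apply_iff hι, ← coe_restrictEquiv ι hι h, ← coe_restrictEquiv ι hι h,
        Equiv.apply_symm_apply, Equiv.apply_symm_apply]
    · ext x
      simp
  · rintro ⟨W, hW, rfl⟩ y hy
    obtain ⟨γ, hγ⟩ := isOpen_cone_iff.1 hW _ hy
    exact ⟨ι γ, fun z hz => hγ _ ((agreeFrom_apply_iff hι).1 hz)⟩

/-- If the remaining coordinates are bounded below, removing trivial coordinates leads to the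
wreath product over finite supports. -/
lemma topIso_restrict_of_bounded [Nonempty Δ] (ι : Γ ↪o Δ)
    (hι : ∀ δ, δ ∉ Set.range ι → N δ = 1) {β : Δ} (hβ : ∀ γ, β ≤ ι γ) :
    @TopIso (WrSym N (LFSupp Δ)) _ (tau N (LFSupp Δ))
      (WrSym (fun γ => N (ι γ)) (FinSupp Γ)) _ (tauStar (fun γ => N (ι γ)) (FinSupp Γ)) := by
  have h : ∀ B, B ∈ FinSupp Γ ↔ ι '' B ∈ LFSupp Δ := by
    refine fun B => ⟨fun hB δ => (hB.image ι).subset Set.inter_subset_left, fun hB => ?_⟩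
    refine Set.Finite.of_finite_image ((hB β).subset ?_) ι.injective.injOn
    rintro _ ⟨ε, hε, rfl⟩
    exact ⟨⟨ε, hε, rfl⟩, hβ ε⟩
  refine topIso_restrict ι hι h isStable_lfSupp isStable_finSupp _ _
    (TopologicalSpace.ext_iff.2 fun V => ?_)
  refine isOpen_cone_iff.trans ?_
  -- The cone at `β` contains all nontrivial coordinates, so it is a single point and every set is
  -- open.
  refine ⟨fun _ => ⟨(restrictEquiv ι hι h).symm ⁻¹' V, trivial, by ext; simp⟩, fun _ y hy =>
    ⟨β, fun z hz => ?_⟩⟩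
  suffices z = y from this ▸ hy
  refine (restrictEquiv ι hι h).injective (Subtype.ext (funext fun γ => ?_))
  exact (agreeFrom_iff_of_range hι).1 hz γ (hβ γ)

end Restrict

/-! ### Scales and the metric on locally finite sequences -/

/-- A strictly increasing labeling of `Δ` by positive reals whose values below suitable elements
of `Δ` are arbitrarily small. -/
structure Scale (Δ : Type*) [LinearOrder Δ] where
  toFun : Δ → ℝ
  strictMono : StrictMono toFun
  pos : ∀ δ, 0 < toFun δ
  small : ∀ ε > 0, ∃ γ, ∀ δ < γ, toFun δ < ε

instance (Δ : Type*) [LinearOrder Δ] : CoeFun (Scale Δ) (fun _ => Δ → ℝ) := ⟨Scale.toFun⟩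

/-- Every nonempty countable linear order carries a scale, `δ ↦ ∑ γ ≤ δ, 2 ^ (-e γ)` for an
enumeration `e`. -/
theorem nonempty_scale (Δ : Type*) [LinearOrder Δ] [Countable Δ] [Nonempty Δ] :
    Nonempty (Scale Δ) := by
  classical
  obtain ⟨_⟩ := nonempty_encodable Δ
  obtain ⟨w, hw0, c, hw, -⟩ := posSumOfEncodable one_pos Δ
  have hsum : ∀ A : Set Δ, Summable (A.indicator w) := fun A => hw.summable.indicator A
  have hnn : ∀ (A : Set Δ) γ, 0 ≤ A.indicator w γ := fun A γ =>
    Set.indicator_nonneg (fun γ _ => (hw0 γ).le) γ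
  refine ⟨⟨fun δ => ∑' γ, (Set.Iic δ).indicator w γ, fun δ ε h => ?_, fun δ => ?_,
    fun r hr => ?_⟩⟩
  · refine Summable.tsum_lt_tsum (i := ε) (fun γ => ?_) ?_ (hsum _) (hsum _)
    · exact Set.indicator_le_indicator_of_subset (Set.Iic_subset_Iic.2 h.le)
        (fun γ => (hw0 γ).le) γ
    · rw [Set.indicator_of_notMem (by simpa using h), Set.indicator_of_mem Set.self_mem_Iic]
      exact hw0 ε
  · refine (hsum _).tsum_pos (hnn _) δ ?_
    rw [Set.indicator_of_mem Set.self_mem_Iic]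
    exact hw0 δ
  -- A finite set `s` carries all but less than `r` of the total weight. Below a lower bound of `s`,
  -- the sum meets only the weight outside `s`.
  · obtain ⟨s, hs⟩ := (hw.eventually (lt_mem_nhds (sub_lt_self c hr))).exists
    have hlt : ∑' γ, ((s : Set Δ)ᶜ).indicator w γ < r := by
      have h1 := hw.summable.sum_add_tsum_compl (s := s)
      rw [hw.tsum_eq, tsum_subtype ((s : Set Δ)ᶜ) w] at h1
      linarith
    obtain ⟨γ, hγ⟩ : ∃ γ, ∀ ε ∈ s, γ ≤ ε := by
      rcases s.eq_empty_or_nonempty with rfl | hne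
      · exact ⟨Classical.arbitrary Δ, by simp⟩
      · exact ⟨s.min' hne, s.min'_le⟩
    refine ⟨γ, fun δ hδ => lt_of_le_of_lt ((hsum _).tsum_le_tsum (fun ε => ?_) (hsum _)) hlt⟩
    refine Set.indicator_le_indicator_of_subset (fun ε hε hmem => ?_) (fun γ => (hw0 γ).le) ε
    exact ((hγ ε hmem).trans hε).not_gt hδ

/-- The locally finite sequences, to be measured by the scale `f`. -/
@[ext]
structure ScaleSpace {Δ : Type*} [LinearOrder Δ] (N : Δ → ℕ∞) (f : Scale Δ) where
  toDomain : domainOf N (LFSupp Δ)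

namespace ScaleSpace

variable {Δ : Type*} [LinearOrder Δ] {N : Δ → ℕ∞} {f : Scale Δ}

/-- The underlying sequence. -/
abbrev seq (x : ScaleSpace N f) : ∀ δ, Coord N δ := x.toDomain.1

lemma ext_seq {x y : ScaleSpace N f} (h : ∀ δ, x.seq δ = y.seq δ) : x = y :=
  ScaleSpace.ext (Subtype.ext (funext h))

/-- Two different sequences differ at a largest place. -/
lemma exists_leading {x y : ScaleSpace N f} (h : x ≠ y) :
    ∃ δ, x.seq δ ≠ y.seq δ ∧ ∀ γ, δ < γ → x.seq γ = y.seq γ := by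
  obtain ⟨δ₀, h₀⟩ : ∃ δ, x.seq δ ≠ y.seq δ := by
    by_contra! h'
    exact h (ext_seq h')
  -- Above `δ₀` the places of difference lie in the union of the two supports, which is finite
  -- there, so a largest one exists.
  have hfin : {γ | δ₀ ≤ γ ∧ x.seq γ ≠ y.seq γ}.Finite := by
    refine ((x.toDomain.2 δ₀).union (y.toDomain.2 δ₀)).subset ?_
    rintro γ ⟨hγ, hne⟩
    by_cases hx : (x.seq γ : ℕ) = 0
    · refine Or.inr ⟨fun hy : (y.seq γ : ℕ) = 0 => hne (Subtype.ext (hx.trans hy.symm)), hγ⟩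
    · exact Or.inl ⟨hx, hγ⟩
  obtain ⟨δ, ⟨hδ₀, hδ⟩, hmax⟩ := Set.exists_max_image _ id hfin ⟨δ₀, le_rfl, h₀⟩
  refine ⟨δ, hδ, fun γ hγ => ?_⟩
  by_contra hne
  exact (hmax γ ⟨hδ₀.trans hγ.le, hne⟩).not_gt hγ

open Classical in
noncomputable instance : Dist (ScaleSpace N f) where
  dist x y := if h : x = y then 0 else f (exists_leading h).choose

lemma dist_self' (x : ScaleSpace N f) : dist x x = 0 := dif_pos rfl

lemma dist_eq_of_leading {x y : ScaleSpace N f} {δ : Δ} (h : x.seq δ ≠ y.seq δ)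
    (h' : ∀ γ, δ < γ → x.seq γ = y.seq γ) : dist x y = f δ := by
  have hne : x ≠ y := fun hxy => h (hxy ▸ rfl)
  obtain ⟨h1, h2⟩ := (exists_leading hne).choose_spec
  have : (exists_leading hne).choose = δ := by
    rcases lt_trichotomy (exists_leading hne).choose δ with hlt | heq | hlt
    · exact absurd (h2 _ hlt) h
    · exact heq
    · exact absurd (h' _ hlt) h1
  exact (dif_neg hne).trans (congrArg f this)

/-- The dictionary between metric and order: the largest place of difference lies below `δ` exactly
when the cone above `δ` sees no difference. -/
lemma dist_lt_iff {x y : ScaleSpace N f} {δ : Δ} :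
    dist x y < f δ ↔ AgreeFrom δ x.seq y.seq := by
  rcases eq_or_ne x y with rfl | hne
  · rw [dist_self']
    exact ⟨fun _ _ _ => rfl, fun _ => f.pos δ⟩
  · obtain ⟨γ, hγ, hγ'⟩ := exists_leading hne
    rw [dist_eq_of_leading hγ hγ', f.strictMono.lt_iff_lt]
    exact ⟨fun h ε hε => hγ' ε (h.trans_le hε), fun h => not_le.1 fun hle => hγ (h γ hle)⟩

lemma dist_nonneg' (x y : ScaleSpace N f) : 0 ≤ dist x y := by
  rcases eq_or_ne x y with rfl | hne
  · rw [dist_self']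
  · obtain ⟨γ, hγ, hγ'⟩ := exists_leading hne
    exact (dist_eq_of_leading hγ hγ').ge.trans' (f.pos γ).le

lemma dist_comm' (x y : ScaleSpace N f) : dist x y = dist y x := by
  rcases eq_or_ne x y with rfl | hne
  · rfl
  · obtain ⟨γ, hγ, hγ'⟩ := exists_leading hne
    rw [dist_eq_of_leading hγ hγ',
      dist_eq_of_leading hγ.symm fun ε hε => (hγ' ε hε).symm]

lemma dist_triangle_max' (x y z : ScaleSpace N f) : dist x z ≤ max (dist x y) (dist y z) := by
  rcases eq_or_ne x z with rfl | hne
  · rw [dist_self']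
    exact le_max_of_le_left (dist_nonneg' _ _)
  · obtain ⟨γ, hγ, hγ'⟩ := exists_leading hne
    rw [dist_eq_of_leading hγ hγ']
    by_contra! h
    exact hγ (((dist_lt_iff.1 ((le_max_left _ _).trans_lt h)).trans
      (dist_lt_iff.1 ((le_max_right _ _).trans_lt h))) γ le_rfl)

noncomputable instance : MetricSpace (ScaleSpace N f) where
  dist_self := dist_self'
  dist_comm := dist_comm'
  dist_triangle x y z := (dist_triangle_max' x y z).trans
    (max_le_add_of_nonneg (dist_nonneg' _ _) (dist_nonneg' _ _))
  eq_of_dist_eq_zero {x y} h := by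
    by_contra hne
    obtain ⟨γ, hγ, hγ'⟩ := exists_leading hne
    exact (f.pos γ).ne' ((dist_eq_of_leading hγ hγ').symm.trans h)

instance : IsUltrametricDist (ScaleSpace N f) := ⟨dist_triangle_max'⟩

lemma dist_eq_iff {x y : ScaleSpace N f} {δ : Δ} :
    dist x y = f δ ↔ x.seq δ ≠ y.seq δ ∧ ∀ γ, δ < γ → x.seq γ = y.seq γ := by
  refine ⟨fun h => ⟨fun he => ?_, fun γ hγ => ?_⟩, fun h => dist_eq_of_leading h.1 h.2⟩
  · refine h.not_lt (dist_lt_iff.2 fun ε hε => ?_)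
    rcases hε.eq_or_lt with rfl | hε
    · exact he
    · exact dist_lt_iff.1 (h.trans_lt (f.strictMono hε)) ε le_rfl
  · exact dist_lt_iff.1 (h.trans_lt (f.strictMono hγ)) γ le_rfl

lemma dist_le_iff {x y : ScaleSpace N f} {δ : Δ} :
    dist x y ≤ f δ ↔ ∀ γ, δ < γ → x.seq γ = y.seq γ := by
  refine ⟨fun h γ hγ => dist_lt_iff.1 (h.trans_lt (f.strictMono hγ)) γ le_rfl, fun h => ?_⟩
  by_cases he : x.seq δ = y.seq δ
  · refine (dist_lt_iff.2 fun ε hε => ?_).le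
    rcases hε.eq_or_lt with rfl | hε
    · exact he
    · exact h ε hε
  · exact (dist_eq_of_leading he h).le

/-- The smallness of the scale enters only here. Without it the metric could be discrete while the
cone topology is not. -/
lemma exists_dist_lt {ε : ℝ} (hε : 0 < ε) :
    ∃ γ, ∀ x y : ScaleSpace N f, AgreeFrom γ x.seq y.seq → dist x y < ε := by
  obtain ⟨γ, hγ⟩ := f.small ε hε
  refine ⟨γ, fun x y hxy => ?_⟩
  rcases eq_or_ne x y with rfl | hne
  · rwa [dist_self]
  · obtain ⟨δ, hδ, hδ'⟩ := exists_leading hne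
    rw [dist_eq_of_leading hδ hδ']
    exact hγ δ (not_le.1 fun hle => hδ (hxy δ hle))

lemma induced_coneTopology [Nonempty Δ] :
    (inferInstance : TopologicalSpace (ScaleSpace N f)) =
      (TopologicalSpace.induced Subtype.val (coneTopology N)).induced toDomain := by
  refine TopologicalSpace.ext_iff.2 fun V => ?_
  rw [Metric.isOpen_iff]
  constructor
  · intro hV
    refine ⟨{x | mk x ∈ V}, isOpen_cone_iff.2 fun y hy => ?_, rfl⟩
    obtain ⟨ε, hε, hball⟩ := hV _ hy
    obtain ⟨γ, hγ⟩ := exists_dist_lt (N := N) (f := f) hε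
    exact ⟨γ, fun z hz => hball (hγ (mk z) (mk y) hz)⟩
  · rintro ⟨W, hW, rfl⟩ y hy
    obtain ⟨γ, hγ⟩ := isOpen_cone_iff.1 hW _ hy
    exact ⟨f γ, f.pos γ, fun z hz => hγ z.toDomain (dist_lt_iff.1 hz)⟩

/-- Nonzero distances are values of the scale, so a distance is determined by which values of the
scale exceed it. -/
lemma preservesAgreement_iff_isometry {g : ScaleSpace N f → ScaleSpace N f} :
    (∀ x y δ, AgreeFrom δ x.seq y.seq ↔ AgreeFrom δ (g x).seq (g y).seq) ↔ Isometry g := by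
  constructor
  · refine fun h => Isometry.of_dist_eq fun x y => ?_
    simp only [← dist_lt_iff] at h
    have hle : ∀ a b a' b' : ScaleSpace N f, (∀ δ, dist a b < f δ ↔ dist a' b' < f δ) →
        dist a b ≤ dist a' b' := by
      intro a b a' b' h
      rcases eq_or_ne a b with rfl | hne
      · rw [dist_self]
        exact dist_nonneg
      · obtain ⟨δ, hδ, hδ'⟩ := exists_leading hne
        rw [dist_eq_of_leading hδ hδ']
        by_contra! hlt
        exact ((h δ).2 hlt).ne (dist_eq_of_leading hδ hδ')
    exact le_antisymm (hle _ _ _ _ fun δ => (h x y δ).symm) (hle _ _ _ _ (h x y))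
  · intro h x y δ
    rw [← dist_lt_iff, ← dist_lt_iff, h.dist_eq]

/-- The isometry group is the wreath product over locally finite supports. -/
theorem topIso_wreath [Nonempty Δ] :
    @TopIso (ScaleSpace N f ≃ᵢ ScaleSpace N f) _ (isoTopology _)
      (WrSym N (LFSupp Δ)) _ (tau N (LFSupp Δ)) := by
  let φ : ScaleSpace N f ≃ domainOf N (LFSupp Δ) := ⟨toDomain, mk, fun _ => rfl, fun _ => rfl⟩
  let e : (ScaleSpace N f ≃ᵢ ScaleSpace N f) ≃* WrSym N (LFSupp Δ) :=
    { toFun := fun ψ => ⟨φ.permCongr ψ.toEquiv, (mem_wrSym_iff isStable_lfSupp).2 fun x y δ =>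
        preservesAgreement_iff_isometry.2 ψ.isometry (mk x) (mk y) δ⟩
      invFun := fun g => ⟨φ.symm.permCongr g.1, preservesAgreement_iff_isometry.1 fun x y δ =>
        (mem_wrSym_iff isStable_lfSupp).1 g.2 x.toDomain y.toDomain δ⟩
      left_inv := fun ψ => IsometryEquiv.ext fun _ => rfl
      right_inv := fun g => rfl
      map_mul' := fun ψ χ => rfl }
  exact topIso_of_equivariant (tY := TopologicalSpace.induced Subtype.val (coneTopology N))
    (fun (ψ : ScaleSpace N f ≃ᵢ ScaleSpace N f) x => ψ x)
    (fun (g : WrSym N (LFSupp Δ)) x => g.1 x) φ induced_coneTopology e fun ψ x => rfl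

instance : CompleteSpace (ScaleSpace N f) := by
  refine Metric.complete_of_cauchySeq_tendsto fun u hu => ?_
  have hstab : ∀ δ, ∃ n, ∀ m ≥ n, AgreeFrom δ (u m).seq (u n).seq := fun δ => by
    obtain ⟨n, hn⟩ := Metric.cauchySeq_iff'.1 hu (f δ) (f.pos δ)
    exact ⟨n, fun m hm => dist_lt_iff.1 (hn m hm)⟩
  choose n hn using hstab
  -- A Cauchy sequence is eventually constant on each cone. The limit is read off diagonally, and it
  -- is locally finite because on each cone it coincides with a term of the sequence.
  let x : ∀ δ, Coord N δ := fun δ => (u (n δ)).seq δ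
  have hx : ∀ δ, AgreeFrom δ x (u (n δ)).seq := fun δ γ hγ =>
    (hn γ _ (le_max_left _ (n δ)) γ le_rfl).symm.trans (hn δ _ (le_max_right (n γ) _) γ hγ)
  have hxS : x ∈ domainOf N (LFSupp Δ) := fun δ =>
    ((u (n δ)).toDomain.2 δ).subset fun γ hγ => by
      refine ⟨fun h0 => hγ.1 ?_, hγ.2⟩
      rw [hx δ γ hγ.2]
      exact h0
  refine ⟨⟨⟨x, hxS⟩⟩, Metric.tendsto_atTop.2 fun ε hε => ?_⟩
  obtain ⟨γ, hγ⟩ := exists_dist_lt (N := N) (f := f) hε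
  exact ⟨n γ, fun m hm => hγ _ _ ((hn γ m hm).trans (hx γ).symm)⟩

/-- The zero sequence. -/
lemma nonempty (hN : ∀ δ, N δ ≠ 0) : Nonempty (ScaleSpace N f) :=
  ⟨⟨⟨fun δ => ⟨0, pos_iff_ne_zero.2 (hN δ)⟩, fun δ => by simp [supp]⟩⟩⟩

lemma countable_finite_supp [Countable Δ] :
    {x : ScaleSpace N f | (supp x.seq).Finite}.Countable := by
  let F : {x : ScaleSpace N f | (supp x.seq).Finite} → (Δ →₀ ℕ) := fun x =>
    Finsupp.ofSupportFinite (fun δ => (x.1.seq δ : ℕ)) x.2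
  have hF : Function.Injective F := fun x y h => Subtype.ext <| ext_seq fun δ =>
    Subtype.ext (DFunLike.congr_fun h δ)
  exact hF.countable

lemma dense_finite_supp (hN : ∀ δ, N δ ≠ 0) :
    Dense {x : ScaleSpace N f | (supp x.seq).Finite} := by
  refine Metric.dense_iff.2 fun x ε hε => ?_
  obtain ⟨γ, hγ⟩ := exists_dist_lt (N := N) (f := f) hε
  -- Cutting `x` off below `γ` leaves only the finitely many support places in that cone.
  let y : ∀ δ, Coord N δ := fun δ => if γ ≤ δ then x.seq δ else ⟨0, pos_iff_ne_zero.2 (hN δ)⟩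
  have hy : (supp y).Finite := by
    refine (x.toDomain.2 γ).subset fun δ hδ => ?_
    by_cases h : γ ≤ δ
    · refine ⟨?_, h⟩
      simpa [supp, y, h] using hδ
    · simp [supp, y, h] at hδ
  exact ⟨⟨⟨y, fun δ => hy.subset Set.inter_subset_left⟩⟩,
    hγ _ _ fun δ hδ => if_pos hδ, hy⟩

lemma isPolishUltrametric [Countable Δ] (hN : ∀ δ, N δ ≠ 0) :
    IsPolishUltrametric (ScaleSpace N f) where
  nonempty := nonempty hN
  ultrametric := inferInstance
  complete := inferInstance
  secondCountable :=
    have : TopologicalSpace.SeparableSpace (ScaleSpace N f) :=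
      ⟨_, countable_finite_supp, dense_finite_supp hN⟩
    UniformSpace.secondCountable_of_separable _

lemma exists_sphere_point {δ : Δ} (hδ : N δ = ⊤) (a : ScaleSpace N f)
    (A : Finset (ScaleSpace N f)) :
    ∃ u, dist u a = f δ ∧ ∀ b ∈ A, dist a b ≤ f δ → dist u b = f δ := by
  classical
  have : Infinite (Coord N δ) :=
    Infinite.of_injective (fun n : ℕ => ⟨n, by rw [hδ]; exact ENat.natCast_lt_top n⟩)
      fun m n h => congrArg Subtype.val h
  -- A value at `δ` used neither by `a` nor by any point of `A`; placed into `a`, it makes `δ` the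
  -- largest place of difference.
  obtain ⟨i, hi⟩ := Infinite.exists_notMem_finset ((insert a A).image fun b => b.seq δ)
  let u : ScaleSpace N f := ⟨⟨_, isStable_lfSupp.update_mem a.toDomain.2 δ i⟩⟩
  have huδ : u.seq δ = i := Function.update_self δ i a.seq
  have hu : ∀ γ, δ < γ → u.seq γ = a.seq γ := fun γ hγ => Function.update_of_ne hγ.ne' i a.seq
  have key : ∀ b ∈ insert a A, dist a b ≤ f δ → dist u b = f δ := fun b hb hab =>
    dist_eq_iff.2 ⟨fun h => hi (Finset.mem_image.2 ⟨b, hb, h.symm.trans huδ⟩),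
      fun γ hγ => (hu γ hγ).trans (dist_le_iff.1 hab γ hγ)⟩
  exact ⟨u, key a (Finset.mem_insert_self _ _) ((dist_self a).trans_le (f.pos δ).le),
    fun b hb => key b (Finset.mem_insert_of_mem hb)⟩

lemma mem_distanceSet_iff (hN : ∀ δ, N δ = 1 ∨ N δ = ⊤) {r : ℝ} :
    r ∈ distanceSet (ScaleSpace N f) ↔ ∃ δ, N δ = ⊤ ∧ f δ = r := by
  constructor
  · rintro ⟨⟨x, y, rfl⟩, h0⟩
    obtain ⟨δ, hδ, hδ'⟩ := exists_leading (dist_ne_zero.1 h0)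
    exact ⟨δ, (hN δ).resolve_left fun h => hδ (eq_of_coord_one h _ _),
      (dist_eq_of_leading hδ hδ').symm⟩
  · rintro ⟨δ, hδ, rfl⟩
    have hN0 : ∀ δ, N δ ≠ 0 := fun δ => by rcases hN δ with h | h <;> simp [h]
    obtain ⟨a⟩ := nonempty (f := f) hN0
    obtain ⟨u, hu, -⟩ := exists_sphere_point hδ a ∅
    exact ⟨⟨u, a, hu⟩, (f.pos δ).ne'⟩

lemma hasSphereExtension (hN : ∀ δ, N δ = 1 ∨ N δ = ⊤) :
    HasSphereExtension (ScaleSpace N f) := by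
  intro r hr a A
  obtain ⟨δ, hδ, rfl⟩ := (mem_distanceSet_iff hN).1 hr
  exact exists_sphere_point hδ a A

end ScaleSpace

/-! ### The equivalences -/

/-- In an ultrametric space, moving each of two points by less than their distance does not change
it, so all distances occur within a countable dense set. -/
lemma countable_distanceSet {U : Type*} [MetricSpace U] (hU : IsPolishUltrametric U) :
    (distanceSet U).Countable := by
  obtain ⟨_, _, _, _⟩ := hU
  let u := TopologicalSpace.denseSeq U
  refine (Set.countable_range fun p : ℕ × ℕ => dist (u p.1) (u p.2)).mono ?_
  rintro _ ⟨⟨x, y, rfl⟩, h0⟩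
  have hpos : 0 < dist x y := lt_of_le_of_ne dist_nonneg (Ne.symm h0)
  obtain ⟨m, hm⟩ := (TopologicalSpace.denseRange_denseSeq U).exists_dist_lt x hpos
  obtain ⟨n, hn⟩ := (TopologicalSpace.denseRange_denseSeq U).exists_dist_lt y hpos
  refine ⟨(m, n), ?_⟩
  have h1 : dist (u m) y = dist x y := by
    rw [IsUltrametricDist.dist_eq_max_of_dist_ne_dist (u m) x y (by rw [dist_comm]; exact hm.ne),
      max_eq_right (by rw [dist_comm]; exact hm.le)]
  show dist (u m) (u n) = dist x y
  rw [IsUltrametricDist.dist_eq_max_of_dist_ne_dist (u m) y (u n) (by rw [h1]; exact hn.ne'), h1,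
    max_eq_left hn.le]

section Equivalences

variable {G : Type*} [Group G] [TopologicalSpace G]

/-- Universality is applied to the space of one coordinate with infinitely many values, whose points
are pairwise at distance `r`. -/
lemma IsPolishUrysohn.isWide {U : Type} [MetricSpace U] (hU : IsPolishUrysohn U) : IsWide U := by
  intro r hr
  have hr0 : 0 < r := by
    obtain ⟨⟨x, y, rfl⟩, h0⟩ := hr
    exact lt_of_le_of_ne dist_nonneg (Ne.symm h0)
  let f : Scale Unit := ⟨fun _ => r, Subsingleton.strictMono _, fun _ => hr0, fun _ _ =>
    ⟨(), fun δ hδ => absurd hδ (lt_irrefl _)⟩⟩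
  let N : Unit → ℕ∞ := fun _ => ⊤
  obtain ⟨φ, hφ⟩ := hU.universal (ScaleSpace N f)
    (ScaleSpace.isPolishUltrametric fun _ => ENat.top_ne_zero) (fun q hq => by
      obtain ⟨δ, -, rfl⟩ := (ScaleSpace.mem_distanceSet_iff fun _ => Or.inr rfl).1 hq
      exact hr)
  refine ⟨fun n => φ ⟨⟨fun _ => ⟨n, ENat.natCast_lt_top n⟩, fun _ => Set.toFinite _⟩⟩,
    fun m n hmn => ?_⟩
  rw [hφ.dist_eq]
  exact ScaleSpace.dist_eq_of_leading (δ := ()) (fun h => hmn (congrArg Subtype.val h))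
    fun γ hγ => absurd hγ (lt_irrefl _)

lemma IsUrysohnIsoGroup.isHomogeneousWideIsoGroup (h : IsUrysohnIsoGroup G) :
    IsHomogeneousWideIsoGroup G := by
  obtain ⟨U, _, hU, hG⟩ := h
  exact ⟨U, _, hU.polishUltrametric, hU.ultrahomogeneous.isHomogeneous, hU.isWide, hG⟩

lemma IsHomogeneousWideIsoGroup.isQuasiMaximalWreath (h : IsHomogeneousWideIsoGroup G) :
    IsQuasiMaximalWreath G := by
  classical
  obtain ⟨U, _, hU, hh, hw, hG⟩ := h
  have := hU.ultrametric
  -- The positive rationals are added, with label 1 unless they are distances, so that the labels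
  -- accumulate at 0 even if the distances do not, and so that the order is nonempty even if `U` is
  -- a point.
  let D : Set ℝ := {r | 0 < r ∧ (r ∈ distanceSet U ∨ r ∈ Set.range ((↑) : ℚ → ℝ))}
  have hDc : Countable D :=
    (((countable_distanceSet hU).union (Set.countable_range _)).mono fun r hr => hr.2).to_subtype
  have hDn : Nonempty D := ⟨⟨1, one_pos, Or.inr ⟨1, by simp⟩⟩⟩
  let f : Scale D :=
    { toFun := Subtype.val
      strictMono := fun _ _ h => h
      pos := fun δ => δ.2.1
      small := fun ε hε => by
        obtain ⟨q, hq0, hq⟩ := exists_rat_btwn hε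
        exact ⟨⟨q, hq0, Or.inr ⟨q, rfl⟩⟩, fun δ hδ => lt_trans hδ hq⟩ }
  let N : D → ℕ∞ := fun δ => if δ.1 ∈ distanceSet U then ⊤ else 1
  have hN : ∀ δ, N δ = 1 ∨ N δ = ⊤ := fun δ => by
    by_cases h : δ.1 ∈ distanceSet U <;> simp [N, h]
  have hN0 : ∀ δ, N δ ≠ 0 := fun δ => by rcases hN δ with h | h <;> simp [h]
  have hdist : distanceSet U = distanceSet (ScaleSpace N f) := by
    ext r
    rw [ScaleSpace.mem_distanceSet_iff hN]
    constructor
    · intro hr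
      obtain ⟨⟨x, y, rfl⟩, h0⟩ := id hr
      exact ⟨⟨_, lt_of_le_of_ne dist_nonneg (Ne.symm h0), Or.inl hr⟩, if_pos hr, rfl⟩
    · rintro ⟨δ, hδ, rfl⟩
      by_contra h
      have : N δ = 1 := if_neg h
      simp [this] at hδ
  obtain ⟨φ, -⟩ := (ScaleSpace.hasSphereExtension (f := f) hN).exists_isometryEquiv
    (hh.hasSphereExtension hw) (ScaleSpace.isPolishUltrametric hN0) hU hdist ∅
    (by simp [IsometricRel])
  exact ⟨⟨D, N, hN0⟩, hN, hG.trans ((topIso_isometryEquiv φ).trans ScaleSpace.topIso_wreath)⟩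

lemma IsQuasiMaximalWreath.isUrysohnIsoGroup (h : IsQuasiMaximalWreath G) :
    IsUrysohnIsoGroup G := by
  obtain ⟨K, hK, hG⟩ := h
  obtain ⟨f⟩ := nonempty_scale K.Δ
  exact ⟨ScaleSpace K.N f, inferInstance, (ScaleSpace.hasSphereExtension hK).isPolishUrysohn
    (ScaleSpace.isPolishUltrametric K.N_ne_zero), hG.trans ScaleSpace.topIso_wreath.symm⟩

/-- A label `ω` yields two distinct points, and homogeneity an isometry moving one to the other. -/
lemma nontrivial_of_topIso {K : CountableLinearSkeleton} (hK : K.IsQuasiMaximal) {δ : K.Δ}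
    (hδ : K.N δ = ⊤) (hG : TopIso G (WrSym K.N (LFSupp K.Δ)) (tau K.N (LFSupp K.Δ))) :
    Nontrivial G := by
  obtain ⟨f⟩ := nonempty_scale K.Δ
  obtain ⟨a⟩ := ScaleSpace.nonempty (f := f) K.N_ne_zero
  obtain ⟨u, hu, -⟩ := ScaleSpace.exists_sphere_point hδ a ∅
  have hne : u ≠ a := dist_ne_zero.1 (hu.trans_ne (f.pos δ).ne')
  obtain ⟨ψ, hψ⟩ := ((ScaleSpace.hasSphereExtension (f := f) hK).isPolishUrysohn
    (ScaleSpace.isPolishUltrametric K.N_ne_zero)).ultrahomogeneous.isHomogeneous a u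
  have : Nontrivial (ScaleSpace K.N f ≃ᵢ ScaleSpace K.N f) :=
    ⟨ψ, 1, fun h => hne (by rw [← hψ, h]; rfl)⟩
  exact (hG.trans (ScaleSpace.topIso_wreath (f := f)).symm).some.toEquiv.nontrivial

lemma CountableLinearSkeleton.IsMaximal.isQuasiMaximal {K : CountableLinearSkeleton}
    (hK : K.IsMaximal) : K.IsQuasiMaximal :=
  fun δ => Or.inr (hK δ)

lemma IsMaximalWreath.isQuasiMaximalWreath_and_nontrivial (h : IsMaximalWreath G) :
    IsQuasiMaximalWreath G ∧ Nontrivial G := by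
  obtain ⟨K, hK, hG | hG⟩ := h
  · exact ⟨⟨K, hK.isQuasiMaximal, hG⟩,
      nontrivial_of_topIso hK.isQuasiMaximal (hK (Classical.arbitrary K.Δ)) hG⟩
  -- A bottom place of label 1 forces locally finite supports to be finite and makes the cone
  -- topology discrete.
  · let N : WithBot K.Δ → ℕ∞ := fun δ => WithBot.recBotCoe 1 K.N δ
    let ι : K.Δ ↪o WithBot K.Δ := WithBot.coeOrderHom
    have hN : ∀ δ, N δ = 1 ∨ N δ = ⊤ := fun δ => by
      induction δ with
      | bot => exact Or.inl rfl
      | coe δ => exact Or.inr (hK δ)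
    let L : CountableLinearSkeleton :=
      { Δ := WithBot K.Δ
        countable := inferInstanceAs (Countable (Option K.Δ))
        N := N
        N_ne_zero := fun δ => by rcases hN δ with h | h <;> simp [h] }
    have hι : ∀ δ, δ ∉ Set.range ι → N δ = 1 := fun δ hδ => by
      induction δ with
      | bot => rfl
      | coe δ => exact absurd ⟨δ, rfl⟩ hδ
    have hiso := topIso_restrict_of_bounded ι hι (β := ⊥) fun _ => bot_le
    have hL : TopIso G (WrSym L.N (LFSupp L.Δ)) (tau L.N (LFSupp L.Δ)) := hG.trans hiso.symm
    exact ⟨⟨L, hN, hL⟩,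
      nontrivial_of_topIso (K := L) hN (δ := ι (Classical.arbitrary K.Δ)) (hK _) hL⟩

lemma IsQuasiMaximalWreath.isMaximalWreath [Nontrivial G] (h : IsQuasiMaximalWreath G) :
    IsMaximalWreath G := by
  obtain ⟨K, hK, hG⟩ := h
  let ι : {δ : K.Δ // K.N δ = ⊤} ↪o K.Δ := OrderEmbedding.subtype _
  have hι : ∀ δ, δ ∉ Set.range ι → K.N δ = 1 := fun δ hδ =>
    (hK δ).resolve_right fun h => hδ ⟨⟨δ, h⟩, rfl⟩
  have hne : Nonempty {δ : K.Δ // K.N δ = ⊤} := by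
    by_contra hemp
    have hone : ∀ δ, K.N δ = 1 := fun δ => (hK δ).resolve_right fun h => hemp ⟨⟨δ, h⟩⟩
    -- With all labels 1 there is at most one sequence to permute, so the group would be trivial.
    have : Subsingleton (domainOf K.N (LFSupp K.Δ)) :=
      ⟨fun x y => Subtype.ext (funext fun δ => eq_of_coord_one (hone δ) _ _)⟩
    exact not_subsingleton G hG.some.toEquiv.subsingleton
  refine ⟨⟨{δ : K.Δ // K.N δ = ⊤}, fun γ => K.N (ι γ), fun γ => K.N_ne_zero _⟩,
    fun γ => γ.2, ?_⟩
  by_cases hco : ∀ δ, ∃ γ, ι γ ≤ δ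
  · exact Or.inl (hG.trans (topIso_restrict_of_coinitial ι hι hco))
  · push Not at hco
    obtain ⟨β, hβ⟩ := hco
    exact Or.inr (hG.trans (topIso_restrict_of_bounded ι hι fun γ => (hβ γ).le))

end Equivalences

end UltrametricWreath

theorem mainTheorem5 {G : Type*} [Group G] [TopologicalSpace G] [IsTopologicalGroup G] :
    List.TFAE
      [UltrametricWreath.IsUrysohnIsoGroup G,
        UltrametricWreath.IsHomogeneousWideIsoGroup G,
        UltrametricWreath.IsQuasiMaximalWreath G] ∧
    (UltrametricWreath.IsMaximalWreath G ↔
      UltrametricWreath.IsUrysohnIsoGroup G ∧ Nontrivial G) := by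
  refine ⟨?_, fun h => ?_, fun ⟨h, _⟩ => ?_⟩
  · tfae_have 1 → 2 := fun h => h.isHomogeneousWideIsoGroup
    tfae_have 2 → 3 := fun h => h.isQuasiMaximalWreath
    tfae_have 3 → 1 := fun h => h.isUrysohnIsoGroup
    tfae_finish
  · exact h.isQuasiMaximalWreath_and_nontrivial.imp_left fun h => h.isUrysohnIsoGroup
  · exact h.isHomogeneousWideIsoGroup.isQuasiMaximalWreath.isMaximalWreath
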